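/- Let $1\le p<\infty$ be a real number and let $E$ and $F$ be (real) Banach lattices, with dual Banach lattices $E^*$ and $F^*$. A sequence $(x_n)_n$ in a Banach space $X$ is weakly $p$-summable if $\sum_n |x^*(x_n)|^p<\infty$ for every $x^*\in X^*$, and a sequence $(x_n)_n$ in a Banach lattice is disjoint if $|x_m|\wedge|x_n|=0$ for all $m\neq n$. All operators are linear and bounded. A Banach lattice $G$ - has order continuous norm if $\inf_{a\in A}\|a\|=0$ for every nonempty downward directed set $A\subseteq G$ with $\inf A=0$; - has the positive Schur property of order $p$ if every weakly $p$-summable sequence in $G^+$ is norm null. An operator from a Banach lattice $G$ to a Banach space is disjoint $p$-convergent if it maps disjoint weakly $p$-summable sequences of $G$ to norm null sequences. An operator $T\colon E\to F$ is almost weak $p$-convergent if $y_n^*(Tx_n)\to 0$ whenever $(x_n)_n$ is weakly null in $E$ and $(y_n^*)_n$ is a disjoint weakly $p$-summable sequence in $F^*$. **Theorem.** The following conditions are equivalent: (a) $E^*$ has order continuous norm or $F^*$ has the positive Schur property of order $p$. (b) The adjoint $T^*\colon F^*\to E^*$ of every positive almost weak $p$-convergent operator $T\colon E\to F$ is disjoint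 $p$-convergent. (c) Every positive operator $T\colon E\to F$ satisfies: $T$ is almost weak $p$-convergent if and only if $T^*$ is disjoint $p$-convergent. -/

import Mathlib

open Filter Topology

noncomputable section

namespace BanachLat

/-! ### The dual of a real normed vector lattice as a Banach lattice -/

set_option linter.unusedSectionVars false

section Dual

variable {E : Type*} [NormedAddCommGroup E] [Lattice E] [HasSolidNorm E] [IsOrderedAddMonoid E]
  [NormedSpace ℝ E] [IsOrderedModule ℝ E]

/-- The usual order on the topological dual: `f ≤ g` means `f x ≤ g x` for every `x ≥ 0`. -/
instance dualPartialOrder : PartialOrder (StrongDual ℝ E) where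
  le f g := ∀ x : E, 0 ≤ x → f x ≤ g x
  le_refl _ _ _ := le_rfl
  le_trans _ _ _ h₁ h₂ x hx := (h₁ x hx).trans (h₂ x hx)
  le_antisymm f g h₁ h₂ := by
    ext x
    have hp := le_antisymm (h₁ _ (posPart_nonneg x)) (h₂ _ (posPart_nonneg x))
    have hn := le_antisymm (h₁ _ (negPart_nonneg x)) (h₂ _ (negPart_nonneg x))
    rw [← posPart_sub_negPart x, map_sub, map_sub, hp, hn]

theorem dual_le_iff (f g : StrongDual ℝ E) : f ≤ g ↔ ∀ x : E, 0 ≤ x → f x ≤ g x := Iff.rfl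

/-- For `x ≥ 0` this is the Riesz–Kantorovich value `f⁺ x = sup {f y | 0 ≤ y ≤ x}`. -/
def posAux (f : StrongDual ℝ E) (x : E) : ℝ := sSup (f '' Set.Icc 0 x)

theorem norm_le_of_mem_Icc {x y : E} (hy : y ∈ Set.Icc 0 x) : ‖y‖ ≤ ‖x‖ :=
  HasSolidNorm.solid (by rw [abs_of_nonneg hy.1, abs_of_nonneg (hy.1.trans hy.2)]; exact hy.2)

theorem posAux_bddAbove (f : StrongDual ℝ E) (x : E) : BddAbove (f '' Set.Icc 0 x) := by
  refine ⟨‖f‖ * ‖x‖, ?_⟩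
  rintro _ ⟨y, hy, rfl⟩
  exact (le_abs_self _).trans ((f.le_opNorm y).trans
    (mul_le_mul_of_nonneg_left (norm_le_of_mem_Icc hy) (norm_nonneg f)))

theorem le_posAux (f : StrongDual ℝ E) {x y : E} (hy : y ∈ Set.Icc 0 x) : f y ≤ posAux f x :=
  le_csSup (posAux_bddAbove f x) ⟨y, hy, rfl⟩

theorem posAux_le (f : StrongDual ℝ E) {x : E} (hx : 0 ≤ x) {c : ℝ}
    (h : ∀ y ∈ Set.Icc 0 x, f y ≤ c) : posAux f x ≤ c := by
  refine csSup_le ⟨f 0, 0, ⟨le_rfl, hx⟩, rfl⟩ ?_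
  rintro _ ⟨y, hy, rfl⟩
  exact h y hy

theorem posAux_nonneg (f : StrongDual ℝ E) {x : E} (hx : 0 ≤ x) : 0 ≤ posAux f x := by
  have := le_posAux f (x := x) (y := 0) ⟨le_rfl, hx⟩
  simpa using this

theorem posAux_le_norm (f : StrongDual ℝ E) {x : E} (hx : 0 ≤ x) : posAux f x ≤ ‖f‖ * ‖x‖ :=
  posAux_le f hx fun y hy => (le_abs_self _).trans ((f.le_opNorm y).trans
    (mul_le_mul_of_nonneg_left (norm_le_of_mem_Icc hy) (norm_nonneg f)))

theorem posAux_add (f : StrongDual ℝ E) {x y : E} (hx : 0 ≤ x) (hy : 0 ≤ y) :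
    posAux f (x + y) = posAux f x + posAux f y := by
  apply le_antisymm
  · refine posAux_le f (add_nonneg hx hy) fun z hz => ?_
    have h1 : z ⊓ x ∈ Set.Icc 0 x := ⟨le_inf hz.1 hx, inf_le_right⟩
    have h2 : z - z ⊓ x ∈ Set.Icc 0 y := by
      refine ⟨sub_nonneg.2 inf_le_left, ?_⟩
      rw [sub_inf, sub_self]
      exact sup_le hy (sub_le_iff_le_add'.2 hz.2)
    have := add_le_add (le_posAux f h1) (le_posAux f h2)
    rwa [← map_add, add_sub_cancel] at this
  · rw [← le_sub_iff_add_le]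
    refine posAux_le f hx fun a ha => ?_
    rw [le_sub_comm]
    refine posAux_le f hy fun b hb => ?_
    rw [le_sub_iff_add_le', ← map_add]
    exact le_posAux f ⟨add_nonneg ha.1 hb.1, add_le_add ha.2 hb.2⟩

/-- Additive extension of `posAux f` from the positive cone to the whole space. -/
def posAddHom (f : StrongDual ℝ E) : E →+ ℝ :=
  AddMonoidHom.mk' (fun x => posAux f x⁺ - posAux f x⁻) (by
    intro x y
    have key : (x + y)⁺ + (x⁻ + y⁻) = (x⁺ + y⁺) + (x + y)⁻ := by
      have h1 := posPart_sub_negPart x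
      have h2 := posPart_sub_negPart y
      have h3 := posPart_sub_negPart (x + y)
      rw [← sub_eq_zero]
      have : (x + y)⁺ + (x⁻ + y⁻) - (x⁺ + y⁺ + (x + y)⁻)
        = ((x + y)⁺ - (x + y)⁻) - (x⁺ - x⁻) - (y⁺ - y⁻) := by abel
      rw [this, h1, h2, h3]; abel
    have := congrArg (posAux f) key
    rw [posAux_add f (posPart_nonneg _) (add_nonneg (negPart_nonneg _) (negPart_nonneg _)),
      posAux_add f (negPart_nonneg _) (negPart_nonneg _),
      posAux_add f (add_nonneg (posPart_nonneg _) (posPart_nonneg _)) (negPart_nonneg _),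
      posAux_add f (posPart_nonneg _) (posPart_nonneg _)] at this
    linarith)

theorem posAddHom_bound (f : StrongDual ℝ E) (x : E) : ‖posAddHom f x‖ ≤ 2 * ‖f‖ * ‖x‖ := by
  have hp : ‖x⁺‖ ≤ ‖x‖ := HasSolidNorm.solid (by
    rw [abs_of_nonneg (posPart_nonneg x), ← posPart_add_negPart x]
    exact le_add_of_nonneg_right (negPart_nonneg x))
  have hn : ‖x⁻‖ ≤ ‖x‖ := HasSolidNorm.solid (by
    rw [abs_of_nonneg (negPart_nonneg x), ← posPart_add_negPart x]
    exact le_add_of_nonneg_left (posPart_nonneg x))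
  have h1 := posAux_le_norm f (posPart_nonneg x)
  have h2 := posAux_le_norm f (negPart_nonneg x)
  have h3 := posAux_nonneg f (posPart_nonneg x)
  have h4 := posAux_nonneg f (negPart_nonneg x)
  have h5 := mul_le_mul_of_nonneg_left hp (norm_nonneg f)
  have h6 := mul_le_mul_of_nonneg_left hn (norm_nonneg f)
  change |posAux f x⁺ - posAux f x⁻| ≤ _
  rw [abs_le]
  constructor <;> linarith

/-- The positive part `f⁺` of a bounded linear functional. -/
def dualPos (f : StrongDual ℝ E) : StrongDual ℝ E :=
  (posAddHom f).toRealLinearMap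
    (AddMonoidHomClass.continuous_of_bound _ (2 * ‖f‖) (posAddHom_bound f))

theorem dualPos_apply (f : StrongDual ℝ E) {x : E} (hx : 0 ≤ x) : dualPos f x = posAux f x := by
  change posAux f x⁺ - posAux f x⁻ = _
  have h0 : posAux f (0 : E) = 0 := le_antisymm
    (by simpa using posAux_le_norm f (le_refl (0 : E))) (posAux_nonneg f le_rfl)
  rw [posPart_of_nonneg hx, negPart_of_nonneg hx, h0, sub_zero]

theorem le_dualPos (f : StrongDual ℝ E) : f ≤ dualPos f := fun x hx => by
  rw [dualPos_apply f hx]; exact le_posAux f ⟨hx, le_rfl⟩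

theorem dualPos_nonneg (f : StrongDual ℝ E) : 0 ≤ dualPos f := fun x hx => by
  rw [dualPos_apply f hx]; exact posAux_nonneg f hx

theorem dualPos_le {f g : StrongDual ℝ E} (h : f ≤ g) (hg : 0 ≤ g) : dualPos f ≤ g := fun x hx => by
  rw [dualPos_apply f hx]
  refine posAux_le f hx fun y hy => (h y hy.1).trans ?_
  have := hg (x - y) (sub_nonneg.2 hy.2)
  rw [map_sub] at this
  exact sub_nonneg.1 (by simpa using this)

instance dualIsOrderedAddMonoid : IsOrderedAddMonoid (StrongDual ℝ E) where
  add_le_add_left _ _ h c x hx := add_le_add_left (h x hx) (c x)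

/-- The dual is a vector lattice, with `f ⊔ g = g + (f - g)⁺` and `f ⊓ g = f - (f - g)⁺`. -/
instance dualLattice : Lattice (StrongDual ℝ E) where
  __ := dualPartialOrder
  sup f g := g + dualPos (f - g)
  inf f g := f - dualPos (f - g)
  le_sup_left f g := by
    have := add_le_add_right (le_dualPos (f - g)) g
    rwa [add_sub_cancel] at this
  le_sup_right f g := le_add_of_nonneg_right (dualPos_nonneg (f - g))
  sup_le f g h hf hg := by
    have := dualPos_le (sub_le_sub_right hf g) (sub_nonneg.2 hg)
    exact le_sub_iff_add_le'.1 this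
  inf_le_left f g := sub_le_self f (dualPos_nonneg (f - g))
  inf_le_right f g := sub_le_comm.1 (le_dualPos (f - g))
  le_inf h f g hf hg := le_sub_comm.1 (dualPos_le (sub_le_sub_left hg f) (sub_nonneg.2 hf))

instance dualIsOrderedModule : IsOrderedModule ℝ (StrongDual ℝ E) where
  smul_le_smul_of_nonneg_left _ ha _ _ h x hx := mul_le_mul_of_nonneg_left (h x hx) ha
  smul_le_smul_of_nonneg_right _ hb _ _ h x hx := mul_le_mul_of_nonneg_right h (hb x hx)

theorem dual_sup_apply (f g : StrongDual ℝ E) {x : E} (hx : 0 ≤ x) :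
    (f ⊔ g) x = g x + sSup ((f - g) '' Set.Icc 0 x) := by
  change g x + dualPos (f - g) x = _
  rw [dualPos_apply _ hx]; rfl

theorem apply_le_dual_abs (f : StrongDual ℝ E) (x : E) : |f x| ≤ |f| |x| := by
  have hp := posPart_nonneg x
  have hn := negPart_nonneg x
  have a1 := le_abs_self f _ hp
  have a2 := le_abs_self f _ hn
  have a3 := neg_le_abs f _ hp
  have a4 := neg_le_abs f _ hn
  have e1 : f x = f x⁺ - f x⁻ := by rw [← map_sub, posPart_sub_negPart]
  have e2 : |f| |x| = |f| x⁺ + |f| x⁻ := by rw [← map_add, posPart_add_negPart]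
  rw [neg_apply] at a3 a4
  rw [e1, e2, abs_le]
  constructor <;> linarith

theorem dual_abs_apply_le (g : StrongDual ℝ E) {x : E} (hx : 0 ≤ x) : |g| x ≤ ‖g‖ * ‖x‖ := by
  change -g x + dualPos (g - -g) x ≤ _
  rw [dualPos_apply _ hx, neg_add_le_iff_le_add]
  refine posAux_le _ hx fun y hy => ?_
  have h1 : ‖y + y - x‖ ≤ ‖x‖ := HasSolidNorm.solid (by
    rw [abs_of_nonneg hx, abs_le']
    constructor
    · rw [sub_le_iff_le_add]; exact add_le_add hy.2 hy.2
    · rw [neg_sub]; exact sub_le_self _ (add_nonneg hy.1 hy.1))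
  have h2 := (le_abs_self _).trans (g.le_opNorm (y + y - x))
  have h3 := mul_le_mul_of_nonneg_left h1 (norm_nonneg g)
  rw [map_sub, map_add] at h2
  simp only [sub_apply, neg_apply]
  linarith

instance dualHasSolidNorm : HasSolidNorm (StrongDual ℝ E) where
  solid f g h := by
    refine f.opNorm_le_bound (norm_nonneg g) fun x => ?_
    have h1 := (apply_le_dual_abs f x).trans (h |x| (abs_nonneg x))
    have h2 := dual_abs_apply_le g (abs_nonneg x)
    rw [norm_abs_eq_norm] at h2
    exact h1.trans h2

end Dual

/-! ### Sequences -/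

/-- `(x n)` is weakly `p`-summable: `(f (x n)) ∈ ℓ_p` for every bounded linear functional `f`. -/
def WeaklySummable {X : Type*} [NormedAddCommGroup X] [NormedSpace ℝ X] (p : ℝ) (x : ℕ → X) :
    Prop :=
  ∀ f : StrongDual ℝ X, Summable fun n => |f (x n)| ^ p

/-- `(x n)` converges weakly to `0`. -/
def WeaklyNull {X : Type*} [NormedAddCommGroup X] [NormedSpace ℝ X] (x : ℕ → X) : Prop :=
  ∀ f : StrongDual ℝ X, Tendsto (fun n => f (x n)) atTop (𝓝 0)

/-- The terms of the sequence are pairwise disjoint: `|x m| ∧ |x n| = 0` for `m ≠ n`. -/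
def DisjointSeq {E : Type*} [AddCommGroup E] [Lattice E] (x : ℕ → E) : Prop :=
  ∀ m n : ℕ, m ≠ n → |x m| ⊓ |x n| = 0

/-! ### Properties of Banach lattices -/

/-- The norm is order continuous: `inf {‖a‖ | a ∈ A} = 0` for every (nonempty) downward directed
set `A` whose infimum is `0`. -/
def HasOrderContinuousNorm (E : Type*) [NormedAddCommGroup E] [Lattice E] : Prop :=
  ∀ A : Set E, A.Nonempty → DirectedOn (fun a b => b ≤ a) A → IsGLB A 0 →
    ∀ ε : ℝ, 0 < ε → ∃ a ∈ A, ‖a‖ < ε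

/-- The positive Schur property of order `p`: every weakly `p`-summable sequence of positive
elements is norm null. -/
def HasPositiveSchurProperty (p : ℝ) (E : Type*) [NormedAddCommGroup E] [Lattice E]
    [NormedSpace ℝ E] : Prop :=
  ∀ x : ℕ → E, (∀ n, 0 ≤ x n) → WeaklySummable p x → Tendsto x atTop (𝓝 0)

/-! ### Operators -/

section Operators

variable {E F X : Type*}
  [NormedAddCommGroup E] [Lattice E] [NormedSpace ℝ E]
  [NormedAddCommGroup F] [Lattice F] [NormedSpace ℝ F]
  [NormedAddCommGroup X] [NormedSpace ℝ X]

/-- `T` maps positive elements to positive elements. -/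
def IsPositiveOperator (T : E →L[ℝ] F) : Prop := ∀ x : E, 0 ≤ x → 0 ≤ T x

/-- `T` maps disjoint weakly `p`-summable sequences to norm null sequences. -/
def IsDisjointPConvergent (p : ℝ) (T : E →L[ℝ] X) : Prop :=
  ∀ x : ℕ → E, DisjointSeq x → WeaklySummable p x → Tendsto (fun n => T (x n)) atTop (𝓝 0)

/-- The Banach space adjoint `T* : F* → E*`, `T* f = f ∘ T`. -/
def adjointOp (T : E →L[ℝ] F) : StrongDual ℝ F →L[ℝ] StrongDual ℝ E :=
  ContinuousLinearMap.precomp ℝ T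

/-- `T : E → F` is almost weak `p`-convergent: `f n (T (x n)) → 0` whenever `(x n)` is weakly null
in `E` and `(f n)` is disjoint and weakly `p`-summable in `F*`. -/
def IsAlmostWeakPConvergent [HasSolidNorm F] [IsOrderedAddMonoid F] [IsOrderedModule ℝ F]
    (p : ℝ) (T : E →L[ℝ] F) : Prop :=
  ∀ (x : ℕ → E) (f : ℕ → StrongDual ℝ F), WeaklyNull x → DisjointSeq f → WeaklySummable p f →
    Tendsto (fun n => f n (T (x n))) atTop (𝓝 0)

end Operators

end BanachLat

end

/-! Write `⊥` for disjointness. Suppose `E*` has order continuous norm, `T` is positive and almost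
weak `p`-convergent, and `f n` is disjoint and weakly `p`-summable. Then so is `|f n|`
(`WeaklySummable.abs_of_disjoint`), and `‖T* f n‖ ≤ ‖T* |f n|‖`. The functionals `T* |f n|` are
positive and pointwise null. If they were not norm null, some disjoint sequence `y k` in the
positive unit ball of `E` would keep a subsequence away from zero
(`exists_disjoint_of_not_tendsto_norm`). Order continuity makes `y k` weakly null, which contradicts
the hypothesis on `T`. If instead `F*` has the positive Schur property, `|f n|` is already norm
null. Conversely, norm convergence of `T* f n` and boundedness of weakly null sequences always make
`T` almost weak `p`-convergent.

When both alternatives fail, there are positive `f k` in `E*` with order bounded partial sums and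
norms bounded below, and disjoint positive weakly `p`-summable `g k` in `F*` with `g k (y k) ≥ δ'`
for some positive `y k` in the unit ball of `F`. The operator `T x = ∑ f k x • y k` factors through
`ℓ₁`, so by Schur's theorem it sends weakly null sequences to norm null ones and is almost weak
`p`-convergent. Yet `T* g n ≥ g n (y n) • f n` stays away from zero. -/

noncomputable section

namespace BanachLat

set_option linter.unusedSectionVars false

/-! ### Disjointness in lattice-ordered groups. -/

section LatticeGroup

variable {G : Type*} [AddCommGroup G] [Lattice G] [IsOrderedAddMonoid G]

theorem add_inf_le_inf_add_inf {a b c : G} (ha : 0 ≤ a) (hb : 0 ≤ b) (hc : 0 ≤ c) :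
    (a + b) ⊓ c ≤ a ⊓ c + b ⊓ c := by
  rw [add_inf, inf_add, inf_add]
  refine le_inf (le_inf inf_le_left ?_) (le_inf ?_ ?_)
  · exact inf_le_right.trans (le_add_of_nonneg_right hb)
  · exact inf_le_right.trans (le_add_of_nonneg_left ha)
  · exact inf_le_right.trans (le_add_of_nonneg_right hc)

theorem add_inf_eq_zero {a b c : G} (ha : 0 ≤ a) (hb : 0 ≤ b) (hac : a ⊓ c = 0)
    (hbc : b ⊓ c = 0) : (a + b) ⊓ c = 0 := by
  have hc : 0 ≤ c := hac ▸ inf_le_right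
  refine le_antisymm ?_ (le_inf (add_nonneg ha hb) hc)
  simpa [hac, hbc] using add_inf_le_inf_add_inf ha hb hc

theorem nsmul_inf_eq_zero {a c : G} (ha : 0 ≤ a) (hac : a ⊓ c = 0) (n : ℕ) : (n • a) ⊓ c = 0 := by
  induction n with
  | zero => rw [zero_nsmul]; exact inf_eq_left.2 (hac ▸ inf_le_right)
  | succ n ih => rw [succ_nsmul]; exact add_inf_eq_zero (nsmul_nonneg ha n) ha ih hac

theorem inf_eq_zero_of_le {a b c d : G} (ha : 0 ≤ a) (hb : 0 ≤ b) (hac : a ≤ c) (hbd : b ≤ d)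
    (h : c ⊓ d = 0) : a ⊓ b = 0 :=
  le_antisymm ((inf_le_inf hac hbd).trans h.le) (le_inf ha hb)

theorem sum_inf_eq_zero {ι : Type*} (s : Finset ι) {a : ι → G} {c : G} (hc : 0 ≤ c)
    (ha : ∀ i ∈ s, 0 ≤ a i) (h : ∀ i ∈ s, a i ⊓ c = 0) : (∑ i ∈ s, a i) ⊓ c = 0 := by
  classical
  induction s using Finset.induction_on with
  | empty => simpa using hc
  | insert i s hi ih =>
    rw [Finset.sum_insert hi]
    simp only [Finset.mem_insert, forall_eq_or_imp] at ha h
    exact add_inf_eq_zero ha.1 (Finset.sum_nonneg ha.2) h.1 (ih ha.2 h.2)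

theorem add_eq_sup_of_inf_eq_zero {a b : G} (h : a ⊓ b = 0) : a + b = a ⊔ b := by
  rw [← inf_add_sup, h, zero_add]

theorem sum_range_le_of_disjoint {a : ℕ → G} {x : G} (h0 : ∀ i, 0 ≤ a i) (hx : ∀ i, a i ≤ x)
    (hd : ∀ m n, m ≠ n → a m ⊓ a n = 0) (n : ℕ) : ∑ i ∈ Finset.range n, a i ≤ x := by
  induction n with
  | zero => simpa using (h0 0).trans (hx 0)
  | succ n ih =>
    rw [Finset.sum_range_succ, add_eq_sup_of_inf_eq_zero]
    · exact sup_le ih (hx n)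
    · exact sum_inf_eq_zero _ (h0 n) (fun i _ => h0 i)
        fun i hi => hd i n (Finset.mem_range.1 hi).ne

/-- Meeting `|a| ≤ |a + b| + |b|` with `|a|` kills the last term and leaves `|a| ≤ |a + b|`. By
symmetry `|a| ⊔ |b| ≤ |a + b|`, and the join of disjoint elements is their sum. -/
theorem abs_add_eq_of_inf_eq_zero {a b : G} (h : |a| ⊓ |b| = 0) : |a + b| = |a| + |b| := by
  refine le_antisymm (abs_add_le a b) ?_
  rw [add_eq_sup_of_inf_eq_zero h]
  have key : ∀ {a b : G}, |a| ⊓ |b| = 0 → |a| ≤ |a + b| := by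
    intro a b h
    have h1 : |a| ≤ |a + b| + |b| := by
      have := abs_add_le (a + b) (-b)
      rwa [add_neg_cancel_right, abs_neg] at this
    have h2 : |a| ≤ |a + b| ⊓ |a| + |b| ⊓ |a| :=
      (le_inf h1 le_rfl).trans
        (add_inf_le_inf_add_inf (abs_nonneg _) (abs_nonneg _) (abs_nonneg _))
    rw [inf_comm |b|, h, add_zero] at h2
    exact h2.trans inf_le_left
  refine sup_le (key h) ?_
  rw [add_comm]
  exact key (by rwa [inf_comm])

theorem abs_sum_range_of_disjoint {a : ℕ → G} (hd : ∀ m n, m ≠ n → |a m| ⊓ |a n| = 0) (n : ℕ) :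
    |∑ i ∈ Finset.range n, a i| = ∑ i ∈ Finset.range n, |a i| := by
  induction n with
  | zero => simp
  | succ n ih =>
    rw [Finset.sum_range_succ, abs_add_eq_of_inf_eq_zero, ih, Finset.sum_range_succ]
    rw [ih]
    exact sum_inf_eq_zero _ (abs_nonneg _) (fun i _ => abs_nonneg _)
      fun i hi => hd i n (Finset.mem_range.1 hi).ne

end LatticeGroup

section Module

variable {E : Type*} [AddCommGroup E] [Lattice E] [IsOrderedAddMonoid E]
  [Module ℝ E] [IsOrderedModule ℝ E]

theorem smul_inf_eq_zero {a b : E} (ha : 0 ≤ a) (h : a ⊓ b = 0) {c : ℝ} (hc : 0 ≤ c) :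
    (c • a) ⊓ b = 0 := by
  have hb : 0 ≤ b := h ▸ inf_le_right
  obtain ⟨n, hn⟩ := exists_nat_ge c
  refine inf_eq_zero_of_le (smul_nonneg hc ha) hb ?_ le_rfl (nsmul_inf_eq_zero ha h n)
  rw [← Nat.cast_smul_eq_nsmul ℝ]
  exact smul_le_smul_of_nonneg_right hn ha

theorem abs_smul_real (c : ℝ) (a : E) : |c • a| = |c| • |a| := by
  have key : ∀ (c : ℝ) (a : E), |c • a| ≤ |c| • |a| := by
    intro c a
    have h1 : ∀ b : E, c • b ≤ |c| • |b| := fun b => by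
      rcases le_total 0 c with hc | hc
      · rw [abs_of_nonneg hc]
        exact smul_le_smul_of_nonneg_left (le_abs_self b) hc
      · rw [abs_of_nonpos hc]
        have := smul_le_smul_of_nonneg_left (neg_le_abs b) (neg_nonneg.2 hc)
        rwa [smul_neg, neg_smul, neg_neg] at this
    refine abs_le'.2 ⟨h1 a, ?_⟩
    rw [← smul_neg, ← abs_neg a]
    exact h1 _
  refine le_antisymm (key c a) ?_
  rcases eq_or_ne c 0 with rfl | hc
  · simp
  have h := smul_le_smul_of_nonneg_left (key c⁻¹ (c • a)) (abs_nonneg c)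
  rwa [inv_smul_smul₀ hc, smul_smul, abs_inv, mul_inv_cancel₀ (abs_ne_zero.2 hc), one_smul] at h

end Module

/-! ### Positive functionals and their components in principal bands. -/

section Dual

variable {E : Type*} [NormedAddCommGroup E] [Lattice E] [HasSolidNorm E] [IsOrderedAddMonoid E]
  [NormedSpace ℝ E] [IsOrderedModule ℝ E]

theorem dual_apply_mono {f : StrongDual ℝ E} (hf : 0 ≤ f) {x y : E} (h : x ≤ y) : f x ≤ f y := by
  have := hf (y - x) (sub_nonneg.2 h)
  rw [map_sub] at this
  exact sub_nonneg.1 (by simpa using this)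

theorem dual_abs_apply_le_of_nonneg {f : StrongDual ℝ E} (hf : 0 ≤ f) (x : E) :
    |f x| ≤ f |x| := by
  simpa [abs_of_nonneg hf] using apply_le_dual_abs f x

theorem norm_posPart_le (x : E) : ‖x⁺‖ ≤ ‖x‖ := HasSolidNorm.solid (by
  rw [abs_of_nonneg (posPart_nonneg x), ← posPart_add_negPart x]
  exact le_add_of_nonneg_right (negPart_nonneg x))

theorem norm_le_norm_of_nonneg_of_le {x y : E} (hx : 0 ≤ x) (h : x ≤ y) : ‖x‖ ≤ ‖y‖ :=
  norm_le_of_mem_Icc ⟨hx, h⟩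

/-- The easy half of the Riesz–Kantorovich formula for the infimum of two functionals. -/
theorem dual_le_inf_apply (f g : StrongDual ℝ E) {x a : E} (ha : 0 ≤ a) (hax : a ≤ x) :
    (f ⊓ g) x ≤ f a + g (x - a) := by
  have h1 := inf_le_left (a := f) (b := g) a ha
  have h2 := inf_le_right (a := f) (b := g) (x - a) (sub_nonneg.2 hax)
  have := add_le_add h1 h2
  rwa [← map_add, add_sub_cancel] at this

/-- An additive function on the positive cone that is nonnegative and bounded extends to a positive
bounded linear functional. -/
theorem exists_dual_of_additive_on_cone (φ : E → ℝ) (C : ℝ) (h0 : ∀ x, 0 ≤ x → 0 ≤ φ x)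
    (hC : ∀ x, 0 ≤ x → φ x ≤ C * ‖x‖)
    (hadd : ∀ x y, 0 ≤ x → 0 ≤ y → φ (x + y) = φ x + φ y) :
    ∃ g : StrongDual ℝ E, ∀ x, 0 ≤ x → g x = φ x := by
  have hz : φ 0 = 0 := by simpa using hadd 0 0 le_rfl le_rfl
  have hC' : ∀ x, 0 ≤ x → φ x ≤ |C| * ‖x‖ := fun x hx =>
    (hC x hx).trans (mul_le_mul_of_nonneg_right (le_abs_self C) (norm_nonneg x))
  let L : E →+ ℝ := AddMonoidHom.mk' (fun x => φ x⁺ - φ x⁻) (by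
    intro x y
    have key : (x + y)⁺ + (x⁻ + y⁻) = (x⁺ + y⁺) + (x + y)⁻ := by
      have h : (x + y)⁺ - (x + y)⁻ = (x⁺ - x⁻) + (y⁺ - y⁻) := by
        simp only [posPart_sub_negPart]
      rw [sub_eq_iff_eq_add] at h
      rw [h]; abel
    have := congrArg φ key
    rw [hadd _ _ (posPart_nonneg _) (add_nonneg (negPart_nonneg _) (negPart_nonneg _)),
      hadd _ _ (negPart_nonneg _) (negPart_nonneg _),
      hadd _ _ (add_nonneg (posPart_nonneg _) (posPart_nonneg _)) (negPart_nonneg _),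
      hadd _ _ (posPart_nonneg _) (posPart_nonneg _)] at this
    linarith)
  have hL : ∀ x, ‖L x‖ ≤ |C| * ‖x‖ := by
    intro x
    have hn : ‖x⁻‖ ≤ ‖x‖ := by
      have := norm_posPart_le (-x)
      rwa [posPart_neg, norm_neg] at this
    have h1 := (hC' _ (posPart_nonneg x)).trans
      (mul_le_mul_of_nonneg_left (norm_posPart_le x) (abs_nonneg C))
    have h2 := (hC' _ (negPart_nonneg x)).trans (mul_le_mul_of_nonneg_left hn (abs_nonneg C))
    have h3 := h0 _ (posPart_nonneg x)
    have h4 := h0 _ (negPart_nonneg x)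
    change |φ x⁺ - φ x⁻| ≤ _
    rw [abs_le]
    constructor <;> linarith
  refine ⟨L.toRealLinearMap (AddMonoidHomClass.continuous_of_bound L |C| hL), fun x hx => ?_⟩
  change φ x⁺ - φ x⁻ = φ x
  rw [posPart_of_nonneg hx, negPart_of_nonneg hx, hz, sub_zero]

/-- `g` is the component of the functional `f` in the band generated by `u`:
`g x = lim f (x ⊓ k u)` on the positive cone. -/
def IsComponent (f : StrongDual ℝ E) (u : E) (g : StrongDual ℝ E) : Prop :=
  ∀ x : E, 0 ≤ x → Tendsto (fun k : ℕ => f (x ⊓ k • u)) atTop (𝓝 (g x))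

/-- The sequence is increasing and bounded by `f x`. Additivity of the limit comes from `(x + y) ⊓ k
u ≤ x ⊓ k u + y ⊓ k u ≤ (x + y) ⊓ 2k u`. -/
theorem exists_isComponent {f : StrongDual ℝ E} (hf : 0 ≤ f) {u : E} (hu : 0 ≤ u) :
    ∃ g, IsComponent f u g := by
  have hmono : ∀ x : E, Monotone fun k : ℕ => f (x ⊓ k • u) := fun x k l hkl =>
    dual_apply_mono hf (inf_le_inf_left x (nsmul_le_nsmul_left hu hkl))
  have hbdd : ∀ x : E, BddAbove (Set.range fun k : ℕ => f (x ⊓ k • u)) := fun x =>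
    ⟨f x, by rintro _ ⟨k, rfl⟩; exact dual_apply_mono hf inf_le_left⟩
  have hlim : ∀ x : E, Tendsto (fun k : ℕ => f (x ⊓ k • u)) atTop
      (𝓝 (⨆ k : ℕ, f (x ⊓ k • u))) := fun x => tendsto_atTop_ciSup (hmono x) (hbdd x)
  have hku : ∀ k : ℕ, 0 ≤ k • u := fun k => nsmul_nonneg hu k
  obtain ⟨g, hg⟩ := exists_dual_of_additive_on_cone (fun x : E => ⨆ k : ℕ, f (x ⊓ k • u)) ‖f‖
    (fun x hx => ge_of_tendsto' (hlim x) fun k => hf _ (le_inf hx (hku k)))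
    (fun x hx => le_of_tendsto' (hlim x) fun k =>
      (dual_apply_mono hf inf_le_left).trans ((le_abs_self _).trans (f.le_opNorm x)))
    (fun x y hx hy => by
      apply le_antisymm
      · refine le_of_tendsto_of_tendsto' (hlim (x + y)) ((hlim x).add (hlim y)) fun k => ?_
        rw [← map_add]
        exact dual_apply_mono hf (add_inf_le_inf_add_inf hx hy (hku k))
      · refine le_of_tendsto_of_tendsto' ((hlim x).add (hlim y))
          ((hlim (x + y)).comp (tendsto_id.const_mul_atTop' (zero_lt_two' ℕ))) fun k => ?_
        rw [← map_add]
        refine dual_apply_mono hf (le_inf (add_le_add inf_le_left inf_le_left) ?_)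
        change _ ≤ (2 * k) • u
        rw [two_mul, add_nsmul]
        exact add_le_add inf_le_right inf_le_right)
  exact ⟨g, fun x hx => by rw [hg x hx]; exact hlim x⟩

namespace IsComponent

variable {f g f' g' : StrongDual ℝ E} {u v : E}

theorem nonneg (h : IsComponent f u g) (hf : 0 ≤ f) (hu : 0 ≤ u) : 0 ≤ g := fun x hx =>
  ge_of_tendsto' (h x hx) fun k => hf _ (le_inf hx (nsmul_nonneg hu k))

theorem le (h : IsComponent f u g) (hf : 0 ≤ f) : g ≤ f := fun x hx =>
  le_of_tendsto' (h x hx) fun _ => dual_apply_mono hf inf_le_left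

theorem apply_of_le_nsmul (h : IsComponent f u g) (hu : 0 ≤ u) {x : E} (hx : 0 ≤ x) {k : ℕ}
    (hk : x ≤ k • u) : g x = f x := by
  refine tendsto_nhds_unique (h x hx) (tendsto_const_nhds.congr' ?_)
  filter_upwards [eventually_ge_atTop k] with j hj
  rw [inf_eq_left.2 (hk.trans (nsmul_le_nsmul_left hu hj))]

theorem apply_self (h : IsComponent f u g) (hu : 0 ≤ u) : g u = f u :=
  h.apply_of_le_nsmul hu hu (k := 1) (one_nsmul u).ge

theorem apply_eq_zero (h : IsComponent f u g) (hu : 0 ≤ u) {x : E} (hx : 0 ≤ x)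
    (hxu : x ⊓ u = 0) : g x = 0 := by
  refine tendsto_nhds_unique (h x hx) (tendsto_const_nhds.congr fun k => ?_)
  rw [inf_comm, nsmul_inf_eq_zero hu (by rwa [inf_comm]), map_zero]

/-- Components in disjoint bands are disjoint. -/
theorem inf_eq_zero (h : IsComponent f u g) (h' : IsComponent f' v g') (hf : 0 ≤ f)
    (hf' : 0 ≤ f') (hu : 0 ≤ u) (hv : 0 ≤ v) (huv : u ⊓ v = 0) : g ⊓ g' = 0 := by
  refine le_antisymm (fun x hx => ?_) (le_inf (h.nonneg hf hu) (h'.nonneg hf' hv))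
  -- Split `x` at `a = x ⊓ k v`: `g` vanishes on `a`, which is disjoint from `u`, while `g' (x - a)
  -- = g' x - f' a` tends to zero.
  have hlim : Tendsto (fun k : ℕ => g' x - f' (x ⊓ k • v)) atTop (𝓝 0) := by
    simpa using (tendsto_const_nhds (x := g' x)).sub (h' x hx)
  refine ge_of_tendsto' hlim fun k => ?_
  have hk : 0 ≤ x ⊓ k • v := le_inf hx (nsmul_nonneg hv k)
  have h1 : g (x ⊓ k • v) = 0 := h.apply_eq_zero hu hk
    (inf_eq_zero_of_le hk hu inf_le_right le_rfl
      (nsmul_inf_eq_zero hv (by rwa [inf_comm]) k))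
  have h2 : g' (x ⊓ k • v) = f' (x ⊓ k • v) := h'.apply_of_le_nsmul hv hk inf_le_right
  have := dual_le_inf_apply g g' hk (inf_le_left (b := k • v))
  rwa [h1, zero_add, map_sub, h2] at this

end IsComponent

end Dual

section

variable {E : Type*} [NormedAddCommGroup E] [Lattice E] [HasSolidNorm E] [IsOrderedAddMonoid E]
  [NormedSpace ℝ E] [IsOrderedModule ℝ E]

/-! ### Series of positive functionals with order bounded partial sums. -/

section Series

theorem dual_sum_abs_apply_le {f : ℕ → StrongDual ℝ E} (hf : ∀ n, 0 ≤ f n) {h : StrongDual ℝ E}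
    (hs : ∀ n, ∑ i ∈ Finset.range n, f i ≤ h) (x : E) (n : ℕ) :
    ∑ i ∈ Finset.range n, |f i x| ≤ h |x| := by
  refine (Finset.sum_le_sum fun i _ => dual_abs_apply_le_of_nonneg (hf i) x).trans ?_
  have := hs n |x| (abs_nonneg x)
  rwa [sum_apply] at this

theorem dual_summable_abs_apply {f : ℕ → StrongDual ℝ E} (hf : ∀ n, 0 ≤ f n)
    {h : StrongDual ℝ E} (hs : ∀ n, ∑ i ∈ Finset.range n, f i ≤ h) (x : E) :
    Summable fun k => |f k x| :=
  summable_of_sum_range_le (fun _ => abs_nonneg _) (dual_sum_abs_apply_le hf hs x)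

/-- If the partial sums of the positive functionals `f k` are order bounded and `y` is a bounded
sequence, then `x ↦ ∑ f k x • y k` is a bounded operator. -/
theorem exists_operator_hasSum {f : ℕ → StrongDual ℝ E} (hf : ∀ n, 0 ≤ f n)
    {h : StrongDual ℝ E} (hs : ∀ n, ∑ i ∈ Finset.range n, f i ≤ h)
    {X : Type*} [NormedAddCommGroup X] [NormedSpace ℝ X] [CompleteSpace X] {y : ℕ → X}
    (hy : ∀ k, ‖y k‖ ≤ 1) :
    ∃ T : E →L[ℝ] X, ∀ x, HasSum (fun k => f k x • y k) (T x) := by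
  have hle : ∀ x k, ‖f k x • y k‖ ≤ |f k x| := fun x k => by
    rw [norm_smul, Real.norm_eq_abs]
    exact mul_le_of_le_one_right (abs_nonneg _) (hy k)
  have hsum : ∀ x, Summable fun k => f k x • y k := fun x =>
    Summable.of_norm_bounded (dual_summable_abs_apply hf hs x) (hle x)
  let L : E →ₗ[ℝ] X :=
    { toFun := fun x => ∑' k, f k x • y k
      map_add' := fun x z => by
        rw [← (hsum x).tsum_add (hsum z)]
        simp only [map_add, add_smul]
      map_smul' := fun c x => by
        rw [RingHom.id_apply, ← (hsum x).tsum_const_smul c]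
        simp only [map_smul, smul_eq_mul, mul_smul] }
  refine ⟨L.mkContinuous ‖h‖ fun x => ?_, fun x => (hsum x).hasSum⟩
  have h1 : ‖L x‖ ≤ ∑' k, |f k x| :=
    tsum_of_norm_bounded (dual_summable_abs_apply hf hs x).hasSum (hle x)
  refine h1.trans ((dual_summable_abs_apply hf hs x).tsum_le_of_sum_range_le
    (dual_sum_abs_apply_le hf hs x) |>.trans ?_)
  have h2 := (le_abs_self _).trans (h.le_opNorm |x|)
  rwa [norm_abs_eq_norm] at h2

end Series

/-! ### Order continuity of the dual norm. -/

section OrderContinuous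

/-- The series converges pointwise to a functional `h`. Its tails decrease to zero, hence become
small in norm, and each term is dominated by the tail starting at it. -/
theorem HasOrderContinuousNorm.tendsto_of_sum_le (hE : HasOrderContinuousNorm (StrongDual ℝ E))
    {g : ℕ → StrongDual ℝ E} (hg : ∀ n, 0 ≤ g n) {f : StrongDual ℝ E}
    (hs : ∀ n, ∑ i ∈ Finset.range n, g i ≤ f) : Tendsto g atTop (𝓝 0) := by
  obtain ⟨h, hh⟩ := exists_operator_hasSum hg hs (y := fun _ => (1 : ℝ)) (fun _ => by simp)
  simp only [smul_eq_mul, mul_one] at hh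
  have hmono : Antitone fun n => h - ∑ i ∈ Finset.range n, g i := fun m n hmn =>
    sub_le_sub_left (Finset.sum_le_sum_of_subset_of_nonneg
      (Finset.range_mono hmn) fun i _ _ => hg i) h
  have hnn : ∀ n, 0 ≤ h - ∑ i ∈ Finset.range n, g i := fun n => sub_nonneg.2 fun x hx => by
    rw [sum_apply]
    exact sum_le_hasSum _ (fun i _ => hg i x hx) (hh x)
  have hglb : IsGLB (Set.range fun n => h - ∑ i ∈ Finset.range n, g i) 0 := by
    refine ⟨by rintro _ ⟨n, rfl⟩; exact hnn n, fun b hb x hx => ?_⟩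
    have hlim : Tendsto (fun n => h x - ∑ i ∈ Finset.range n, g i x) atTop (𝓝 0) := by
      simpa using (tendsto_const_nhds (x := h x)).sub (hh x).tendsto_sum_nat
    refine ge_of_tendsto' hlim fun n => ?_
    have := hb ⟨n, rfl⟩ x hx
    simpa using this
  have hdir : DirectedOn (fun a b => b ≤ a) (Set.range fun n => h - ∑ i ∈ Finset.range n, g i) := by
    rintro _ ⟨m, rfl⟩ _ ⟨n, rfl⟩
    exact ⟨_, ⟨max m n, rfl⟩, hmono (le_max_left m n), hmono (le_max_right m n)⟩
  rw [Metric.tendsto_atTop]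
  intro ε hε
  obtain ⟨_, ⟨n, rfl⟩, hn⟩ := hE _ (Set.range_nonempty _) hdir hglb ε hε
  refine ⟨n, fun k hk => ?_⟩
  rw [dist_zero_right]
  refine lt_of_le_of_lt (norm_le_norm_of_nonneg_of_le (hg k) ?_) hn
  have h1 := hnn (k + 1)
  rw [Finset.sum_range_succ, ← sub_sub, sub_nonneg] at h1
  exact h1.trans (hmono hk)

/-- If the norm of the dual is order continuous, then bounded disjoint sequences of positive
elements are weakly null. -/
theorem HasOrderContinuousNorm.weaklyNull_of_disjoint
    (hE : HasOrderContinuousNorm (StrongDual ℝ E)) {x : ℕ → E} (hx : ∀ n, 0 ≤ x n) {C : ℝ}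
    (hC : ∀ n, ‖x n‖ ≤ C) (hd : ∀ m n, m ≠ n → x m ⊓ x n = 0) : WeaklyNull x := by
  have key : ∀ f : StrongDual ℝ E, 0 ≤ f → Tendsto (fun n => f (x n)) atTop (𝓝 0) := by
    intro f hf
    -- The components of `f` in the bands of the `x n` have partial sums below `f`, since the
    -- elements `z ⊓ k x i` are disjoint and below `z`. So they are norm null, and `g n (x n) = f (x
    -- n)`.
    choose g hg using fun n => exists_isComponent hf (hx n)
    have hs : ∀ n, ∑ i ∈ Finset.range n, g i ≤ f := fun n z hz => by
      rw [sum_apply]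
      refine le_of_tendsto' (tendsto_finsetSum _ fun i _ => hg i z hz) fun k => ?_
      rw [← map_sum]
      refine dual_apply_mono hf (sum_range_le_of_disjoint
        (fun i => le_inf hz (nsmul_nonneg (hx i) k)) (fun i => inf_le_left) (fun i j hij => ?_) n)
      refine inf_eq_zero_of_le (le_inf hz (nsmul_nonneg (hx i) k))
        (le_inf hz (nsmul_nonneg (hx j) k)) inf_le_right inf_le_right
        (nsmul_inf_eq_zero (hx i) ?_ k)
      rw [inf_comm]
      exact nsmul_inf_eq_zero (hx j) (hd j i hij.symm) k
    have hlim := (tendsto_norm_zero.comp (hE.tendsto_of_sum_le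
      (fun n => (hg n).nonneg hf (hx n)) hs)).mul_const C
    rw [zero_mul] at hlim
    refine squeeze_zero (fun n => hf _ (hx n)) (fun n => ?_) hlim
    rw [← (hg n).apply_self (hx n)]
    exact (le_abs_self _).trans (((g n).le_opNorm _).trans
      (mul_le_mul_of_nonneg_left (hC n) (norm_nonneg _)))
  intro f
  have := (key _ (posPart_nonneg f)).sub (key _ (negPart_nonneg f))
  rw [sub_zero] at this
  refine this.congr fun n => ?_
  rw [← sub_apply, posPart_sub_negPart]

/-- If the norm of the dual is not order continuous, then there is a sequence of positive
functionals with order bounded partial sums which is bounded away from zero. -/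
theorem exists_sum_le_of_not_hasOrderContinuousNorm
    (hE : ¬ HasOrderContinuousNorm (StrongDual ℝ E)) :
    ∃ δ : ℝ, 0 < δ ∧ ∃ f : ℕ → StrongDual ℝ E, (∀ n, 0 ≤ f n) ∧ (∀ n, δ ≤ ‖f n‖) ∧
      ∃ h, ∀ n, ∑ i ∈ Finset.range n, f i ≤ h := by
  simp only [HasOrderContinuousNorm, not_forall, not_exists, not_and, not_lt] at hE
  obtain ⟨A, ⟨a₀, ha₀⟩, hdir, hglb, ε, hε, hA⟩ := hE
  have hnn : ∀ a ∈ A, 0 ≤ a := fun a ha => hglb.1 ha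
  -- Otherwise there are `c n` in `A` with every smaller element of `A` within `1 / (n + 1)`.
  -- Directedness makes `c` Cauchy, and its limit is a positive lower bound of `A`, hence `0`,
  -- against `ε ≤ ‖c n‖`.
  have key : ∃ δ : ℝ, 0 < δ ∧ ∀ a ∈ A, ∃ b ∈ A, b ≤ a ∧ δ ≤ ‖a - b‖ := by
    by_contra! hcon
    have hpos : ∀ n : ℕ, (0 : ℝ) < 1 / (n + 1) := fun n => Nat.one_div_pos_of_nat
    choose c hcA hc using fun n : ℕ => hcon _ (hpos n)
    have hlow : ∀ a ∈ A, ∀ n, ∃ d, d ≤ a ∧ ‖c n - d‖ < 1 / (n + 1) := fun a ha n => by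
      obtain ⟨d, hdA, hd1, hd2⟩ := hdir _ (hcA n) _ ha
      exact ⟨d, hd2, hc n d hdA hd1⟩
    have hlim : Tendsto (fun n : ℕ => 1 / ((n : ℝ) + 1)) atTop (𝓝 0) :=
      tendsto_one_div_add_atTop_nhds_zero_nat
    have hcauchy : CauchySeq c := by
      refine cauchySeq_of_le_tendsto_0 (fun N : ℕ => 1 / ((N : ℝ) + 1) + 1 / ((N : ℝ) + 1))
        (fun m n N hm hn => ?_) (by simpa using hlim.add hlim)
      obtain ⟨d, hdA, hd1, hd2⟩ := hdir _ (hcA m) _ (hcA n)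
      refine (dist_triangle_right _ _ d).trans ?_
      rw [dist_eq_norm, dist_eq_norm]
      exact add_le_add ((hc m d hdA hd1).le.trans (Nat.one_div_le_one_div hm))
        ((hc n d hdA hd2).le.trans (Nat.one_div_le_one_div hn))
    obtain ⟨l, hl⟩ := cauchySeq_tendsto_of_complete hcauchy
    have hlx : ∀ x, Tendsto (fun n => c n x) atTop (𝓝 (l x)) := fun x =>
      (ContinuousLinearMap.apply ℝ ℝ x).continuous.continuousAt.tendsto.comp hl
    have hl0 : l = 0 := by
      refine le_antisymm (hglb.2 fun a ha x hx => ?_) fun x hx =>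
        ge_of_tendsto' (hlx x) fun n => hnn _ (hcA n) x hx
      have hbound : Tendsto (fun n : ℕ => a x + 1 / ((n : ℝ) + 1) * ‖x‖) atTop (𝓝 (a x)) := by
        simpa using (hlim.mul_const ‖x‖).const_add (a x)
      refine le_of_tendsto_of_tendsto' (hlx x) hbound fun n => ?_
      obtain ⟨d, hda, hd⟩ := hlow a ha n
      have h1 := (le_abs_self _).trans ((c n - d).le_of_opNorm_le hd.le x)
      have h2 := hda x hx
      rw [sub_apply] at h1
      linarith
    rw [hl0, tendsto_zero_iff_norm_tendsto_zero] at hl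
    exact absurd (ge_of_tendsto' hl fun n => hA _ (hcA n)) (not_le.2 hε)
  obtain ⟨δ, hδ, hstep⟩ := key
  choose! b hbA hba hbδ using hstep
  -- Descending repeatedly by a norm of at least `δ`, the successive differences telescope to at
  -- most `a 0`.
  let a : ℕ → StrongDual ℝ E := fun n => b^[n] a₀
  have haA : ∀ n, a n ∈ A := fun n => by
    induction n with
    | zero => exact ha₀
    | succ n ih => simpa only [a, Function.iterate_succ_apply'] using hbA _ ih
  have hsucc : ∀ n, a (n + 1) = b (a n) := fun n => Function.iterate_succ_apply' b n a₀
  refine ⟨δ, hδ, fun n => a n - a (n + 1), fun n => ?_, fun n => ?_, a 0, fun n => ?_⟩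
  · simp only [hsucc]
    exact sub_nonneg.2 (hba _ (haA n))
  · simp only [hsucc]
    exact hbδ _ (haA n)
  · rw [Finset.sum_range_sub']
    exact sub_le_self _ (hnn _ (haA n))

end OrderContinuous

/-! ### Disjointification. -/

section Disjointification

/-- Since `b - c⁻¹ a = -c⁻¹ (a - c b)`, the second factor is dominated by a multiple of the negative
part of `a - c b`. -/
theorem posPart_sub_inf_posPart_sub {c : ℝ} (hc : 0 < c) (a b : E) :
    (a - c • b)⁺ ⊓ (b - c⁻¹ • a)⁺ = 0 := by
  have h : (b - c⁻¹ • a)⁺ ≤ c⁻¹ • (a - c • b)⁻ := by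
    rw [show b - c⁻¹ • a = c⁻¹ • -(a - c • b) by
      rw [neg_sub, smul_sub, inv_smul_smul₀ hc.ne']]
    exact sup_le (smul_le_smul_of_nonneg_left (neg_le_negPart _) (inv_nonneg.2 hc.le))
      (smul_nonneg (inv_nonneg.2 hc.le) (negPart_nonneg _))
  refine inf_eq_zero_of_le (posPart_nonneg _) (posPart_nonneg _) le_rfl h ?_
  rw [inf_comm]
  exact smul_inf_eq_zero (negPart_nonneg _) (by rw [inf_comm, posPart_inf_negPart_eq_zero])
    (inv_nonneg.2 hc.le)

/-- Disjointification of a bounded sequence of positive elements. -/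
theorem exists_disjoint_posPart [CompleteSpace E] {x : ℕ → E} (hx : ∀ n, 0 ≤ x n)
    (h1 : ∀ n, ‖x n‖ ≤ 1) :
    ∃ w : E, 0 ≤ w ∧ ∀ m n, m ≠ n →
      (x m - (4 : ℝ) ^ m • (∑ i ∈ Finset.range m, x i) - ((1 / 2 : ℝ) ^ m) • w)⁺ ⊓
      (x n - (4 : ℝ) ^ n • (∑ i ∈ Finset.range n, x i) - ((1 / 2 : ℝ) ^ n) • w)⁺ = 0 := by
  have hsum : Summable fun i => ((1 / 2 : ℝ) ^ i) • x i := by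
    refine Summable.of_norm_bounded summable_geometric_two fun i => ?_
    rw [norm_smul, Real.norm_of_nonneg (by positivity)]
    exact mul_le_of_le_one_right (by positivity) (h1 i)
  have hnn : ∀ i, 0 ≤ ((1 / 2 : ℝ) ^ i) • x i := fun i => smul_nonneg (by positivity) (hx i)
  refine ⟨∑' i, ((1 / 2 : ℝ) ^ i) • x i, tsum_nonneg hnn, ?_⟩
  have hw : ∀ n, ((1 / 2 : ℝ) ^ n) • x n ≤ ∑' i, ((1 / 2 : ℝ) ^ i) • x i := fun n =>
    hsum.le_tsum n fun i _ => hnn i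
  generalize (∑' i, ((1 / 2 : ℝ) ^ i) • x i) = w at hw
  have hw0 : 0 ≤ w := (hnn 0).trans (hw 0)
  -- The sum subtracted from `x n` contains `4 ^ n x m`. The multiple of `w` subtracted from `x m`
  -- dominates `2 ^ (-m - n) x n`, hence `4 ^ (-n) x n`. So the pair lies below the one of the
  -- previous lemma with `c = 4 ^ n`.
  have key : ∀ m n, m < n →
      (x n - (4 : ℝ) ^ n • (∑ i ∈ Finset.range n, x i) - ((1 / 2 : ℝ) ^ n) • w)⁺ ⊓
      (x m - (4 : ℝ) ^ m • (∑ i ∈ Finset.range m, x i) - ((1 / 2 : ℝ) ^ m) • w)⁺ = 0 := by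
    intro m n hmn
    refine inf_eq_zero_of_le (posPart_nonneg _) (posPart_nonneg _) (posPart_mono ?_)
      (posPart_mono ?_) (posPart_sub_inf_posPart_sub (c := (4 : ℝ) ^ n) (by positivity) (x n) (x m))
    · refine (sub_le_self _ (smul_nonneg (by positivity) hw0)).trans (sub_le_sub_left ?_ _)
      exact smul_le_smul_of_nonneg_left (Finset.single_le_sum (fun i _ => hx i)
        (Finset.mem_range.2 hmn)) (by positivity)
    · refine sub_le_sub (sub_le_self _ (smul_nonneg (by positivity)
        (Finset.sum_nonneg fun i _ => hx i))) ?_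
      refine le_trans ?_ (smul_le_smul_of_nonneg_left (hw n) (by positivity))
      rw [smul_smul]
      refine smul_le_smul_of_nonneg_right ?_ (hx n)
      rw [← pow_add, show (4 : ℝ) = (1 / 2)⁻¹ ^ 2 by norm_num, ← pow_mul, inv_pow, inv_inv]
      exact pow_le_pow_of_le_one (by norm_num) (by norm_num) (by omega)
  intro m n hmn
  rcases hmn.lt_or_gt with h | h
  · rw [inf_comm]; exact key m n h
  · exact key n m h

theorem exists_nonneg_lt_apply {g : StrongDual ℝ E} (hg : 0 ≤ g) {r : ℝ}
    (hr : r < ‖g‖) : ∃ x : E, 0 ≤ x ∧ ‖x‖ ≤ 1 ∧ r < g x := by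
  obtain ⟨x, hx1, hx⟩ := g.exists_lt_apply_of_lt_opNorm hr
  refine ⟨|x|, abs_nonneg x, by rw [norm_abs_eq_norm]; exact hx1.le,
    hx.trans_le (dual_abs_apply_le_of_nonneg hg x)⟩

/-- A pointwise null sequence of positive functionals which is not norm null is bounded away
from zero, along a subsequence, on a disjoint sequence of the positive unit ball. -/
theorem exists_disjoint_of_not_tendsto_norm [CompleteSpace E] {g : ℕ → StrongDual ℝ E}
    (hg : ∀ n, 0 ≤ g n) (hp : ∀ x, Tendsto (fun n => g n x) atTop (𝓝 0))
    (hn : ¬ Tendsto g atTop (𝓝 0)) :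
    ∃ δ : ℝ, 0 < δ ∧ ∃ φ : ℕ → ℕ, StrictMono φ ∧ ∃ y : ℕ → E, (∀ k, 0 ≤ y k) ∧
      (∀ k, ‖y k‖ ≤ 1) ∧ (∀ m n, m ≠ n → y m ⊓ y n = 0) ∧ ∀ k, δ ≤ g (φ k) (y k) := by
  obtain ⟨ε, hε, hfreq⟩ : ∃ ε : ℝ, 0 < ε ∧ ∃ᶠ n in atTop, ε < ‖g n‖ := by
    by_contra! hcon
    refine hn (tendsto_zero_iff_norm_tendsto_zero.2 (Metric.tendsto_atTop.2 fun ε hε => ?_))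
    have := hcon (ε / 2) (half_pos hε)
    obtain ⟨N, hN⟩ := eventually_atTop.1 this
    refine ⟨N, fun n hn => ?_⟩
    have := hN n hn
    rw [dist_zero_right, norm_norm]
    linarith
  obtain ⟨ψ, hψ, hψε⟩ := extraction_of_frequently_atTop hfreq
  choose u hu0 hu1 hu using fun k => exists_nonneg_lt_apply (hg (ψ k)) (hψε k)
  have hpψ : ∀ x, Tendsto (fun n => g (ψ n) x) atTop (𝓝 0) := fun x => (hp x).comp hψ.tendsto_atTop
  have hnext : ∀ k M : ℕ, ∃ N, M < N ∧
      g (ψ N) ((4 : ℝ) ^ (k + 1) • ∑ i ∈ Finset.range (M + 1), u i) < ε / 4 := fun k M =>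
    ((eventually_gt_atTop M).and ((hpψ _).eventually (gt_mem_nhds (by positivity)))).exists
  choose next hlt hnext using hnext
  -- Sparse indices: since `θ` increases, the sum up to `M = θ k` covers all earlier `u (θ i)`, so
  -- subtracting them costs at most `ε / 4`. Another `ε / 4` goes to `w`, once the first `K` indices
  -- are dropped.
  let θ : ℕ → ℕ := fun n => Nat.rec 0 next n
  have hθ : StrictMono θ := strictMono_nat_of_lt_succ fun k => hlt k (θ k)
  have hsmall : ∀ k, g (ψ (θ k)) ((4 : ℝ) ^ k • ∑ i ∈ Finset.range k, u (θ i)) ≤ ε / 4 := by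
    rintro (_ | k)
    · simpa using div_nonneg hε.le zero_le_four
    · refine le_trans (dual_apply_mono (hg _)
        (smul_le_smul_of_nonneg_left ?_ (by positivity))) (hnext k (θ k)).le
      rw [← Finset.sum_image (f := u) (g := θ) fun i _ j _ h => hθ.injective h]
      refine Finset.sum_le_sum_of_subset_of_nonneg ?_ fun i _ _ => hu0 i
      intro j hj
      obtain ⟨i, hi, rfl⟩ := Finset.mem_image.1 hj
      exact Finset.mem_range.2 (Nat.lt_succ_of_le
        (hθ.monotone (Nat.le_of_lt_succ (Finset.mem_range.1 hi))))
  obtain ⟨w, hw0, hw⟩ := exists_disjoint_posPart (fun n => hu0 (θ n)) (fun n => hu1 (θ n))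
  obtain ⟨K, hK⟩ := eventually_atTop.1 (((hpψ w).comp hθ.tendsto_atTop).eventually
    (gt_mem_nhds (show 0 < ε / 4 by positivity)))
  refine ⟨ε / 2, by positivity, fun k => ψ (θ (k + K)),
    hψ.comp (hθ.comp (strictMono_id.add_const K)), _,
    fun k => posPart_nonneg (u (θ (k + K)) - (4 : ℝ) ^ (k + K) •
      (∑ i ∈ Finset.range (k + K), u (θ i)) - ((1 / 2 : ℝ) ^ (k + K)) • w), fun k => ?_,
    fun m n hmn => hw _ _ (by omega), fun k => ?_⟩
  · refine (norm_le_norm_of_nonneg_of_le (posPart_nonneg _) ?_).trans (hu1 (θ (k + K)))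
    refine sup_le ?_ (hu0 _)
    rw [sub_sub]
    exact sub_le_self _ (add_nonneg (smul_nonneg (by positivity)
      (Finset.sum_nonneg fun i _ => hu0 _)) (smul_nonneg (by positivity) hw0))
  · refine le_trans ?_ (dual_apply_mono (hg _) (le_posPart _))
    have h1 := hsmall (k + K)
    have h2 := hu (θ (k + K))
    have h3 : g (ψ (θ (k + K))) w < ε / 4 := hK (k + K) (Nat.le_add_left K k)
    have h4 : (1 / 2 : ℝ) ^ (k + K) * g (ψ (θ (k + K))) w ≤ g (ψ (θ (k + K))) w :=
      mul_le_of_le_one_left (hg _ w hw0) (pow_le_one₀ (by norm_num) (by norm_num))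
    rw [map_sub, map_sub, map_smul _ ((1 / 2 : ℝ) ^ (k + K)) w, smul_eq_mul]
    linarith

end Disjointification

end

/-! ### Weakly `p`-summable sequences. -/

section WeaklySummable

variable {X : Type*} [NormedAddCommGroup X] [NormedSpace ℝ X] {p : ℝ}

theorem WeaklySummable.weaklyNull (hp : 0 < p) {x : ℕ → X} (hx : WeaklySummable p x) :
    WeaklyNull x := by
  intro f
  have h := (hx f).tendsto_atTop_zero.rpow_const (p := p⁻¹) (Or.inr (inv_nonneg.2 hp.le))
  rw [Real.zero_rpow (inv_ne_zero hp.ne')] at h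
  refine (tendsto_zero_iff_abs_tendsto_zero _).2 (h.congr fun n => ?_)
  rw [Real.rpow_rpow_inv (abs_nonneg _) hp.ne']
  rfl

theorem WeaklySummable.comp_injective {x : ℕ → X} (hx : WeaklySummable p x) {φ : ℕ → ℕ}
    (hφ : Function.Injective φ) : WeaklySummable p (x ∘ φ) := fun f =>
  (hx f).comp_injective hφ

theorem WeaklyNull.exists_norm_le {x : ℕ → X} (hx : WeaklyNull x) : ∃ C, ∀ n, ‖x n‖ ≤ C := by
  obtain ⟨C, hC⟩ := banach_steinhaus
    (g := fun n => NormedSpace.inclusionInDoubleDual ℝ X (x n)) (fun f => by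
      obtain ⟨C, hC⟩ := (hx f).norm.bddAbove_range
      exact ⟨C, fun n => hC ⟨n, rfl⟩⟩)
  exact ⟨C, fun n => by
    rw [← (NormedSpace.inclusionInDoubleDualLi ℝ (E := X)).norm_map (x n)]; exact hC n⟩

/-- Hölder's inequality with the extremal weights `c ^ (p - 1)`. -/
theorem sum_rpow_div_mul_le (hp : 1 ≤ p) {a c : ℕ → ℝ} (ha : ∀ i, 0 ≤ a i) (hc : ∀ i, 0 ≤ c i)
    (s : Finset ℕ) :
    ∑ i ∈ s, c i ^ p / c i * a i ≤
      (∑ i ∈ s, c i ^ p) ^ (1 - p⁻¹) * (∑ i ∈ s, a i ^ p) ^ p⁻¹ := by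
  have h := Real.inner_le_weight_mul_Lp_of_nonneg s hp (fun i => c i ^ p) (fun i => a i / c i)
    (fun i => Real.rpow_nonneg (hc i) p) (fun i => div_nonneg (ha i) (hc i))
  have hp0 : p ≠ 0 := by linarith
  refine le_trans (le_of_eq (Finset.sum_congr rfl fun i _ => by ring)) (h.trans ?_)
  refine mul_le_mul_of_nonneg_left (Real.rpow_le_rpow (Finset.sum_nonneg fun i _ =>
    mul_nonneg (Real.rpow_nonneg (hc i) p) (Real.rpow_nonneg (div_nonneg (ha i) (hc i)) p))
    (Finset.sum_le_sum fun i _ => ?_) (by positivity))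
    (Real.rpow_nonneg (Finset.sum_nonneg fun i _ => Real.rpow_nonneg (hc i) p) _)
  rw [← Real.mul_rpow (hc i) (div_nonneg (ha i) (hc i))]
  rcases eq_or_ne (c i) 0 with h0 | h0
  · rw [h0, zero_mul, Real.zero_rpow hp0]
    exact Real.rpow_nonneg (ha i) p
  · rw [mul_div_cancel₀ _ h0]

/-- Hölder bounds each functional on the normalised sums, and the uniform boundedness principle
makes the bound uniform. The weight is written `c ^ p / c` so that it vanishes at `c = 0` even when
`p = 1`. -/
theorem WeaklySummable.exists_norm_sum_le (hp : 1 ≤ p) {x : ℕ → X} (hx : WeaklySummable p x) :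
    ∃ C, ∀ (n : ℕ) (c : ℕ → ℝ), (∀ i, 0 ≤ c i) →
      ‖∑ i ∈ Finset.range n, (c i ^ p / c i) • x i‖ ≤
        C * (∑ i ∈ Finset.range n, c i ^ p) ^ (1 - p⁻¹) := by
  let S : ℕ × {c : ℕ → ℝ // ∀ i, 0 ≤ c i} → ℝ := fun q =>
    (∑ i ∈ Finset.range q.1, q.2.1 i ^ p) ^ (1 - p⁻¹)
  have hS : ∀ q, 0 ≤ S q := fun q =>
    Real.rpow_nonneg (Finset.sum_nonneg fun i _ => Real.rpow_nonneg (q.2.2 i) p) _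
  let z : ℕ × {c : ℕ → ℝ // ∀ i, 0 ≤ c i} → X := fun q =>
    ∑ i ∈ Finset.range q.1, (q.2.1 i ^ p / q.2.1 i) • x i
  have hz : ∀ (f : StrongDual ℝ X) q, |f (z q)| ≤ S q * (∑' i, |f (x i)| ^ p) ^ p⁻¹ := by
    intro f q
    have h1 : |f (z q)| ≤ ∑ i ∈ Finset.range q.1, q.2.1 i ^ p / q.2.1 i * |f (x i)| := by
      simp only [z, map_sum, map_smul, smul_eq_mul]
      refine (Finset.abs_sum_le_sum_abs _ _).trans (Finset.sum_le_sum fun i _ => ?_)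
      rw [abs_mul, abs_of_nonneg (div_nonneg (Real.rpow_nonneg (q.2.2 i) p) (q.2.2 i))]
    refine h1.trans ((sum_rpow_div_mul_le hp (fun i => abs_nonneg (f (x i))) q.2.2 _).trans
      (mul_le_mul_of_nonneg_left (Real.rpow_le_rpow ?_ ?_ (by positivity)) (hS q)))
    · exact Finset.sum_nonneg fun i _ => Real.rpow_nonneg (abs_nonneg _) p
    · exact (hx f).sum_le_tsum _ fun i _ => Real.rpow_nonneg (abs_nonneg _) p
  obtain ⟨C, hC⟩ := banach_steinhaus
    (g := fun q => NormedSpace.inclusionInDoubleDual ℝ X ((S q)⁻¹ • z q)) (fun f => by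
      refine ⟨(∑' i, |f (x i)| ^ p) ^ p⁻¹, fun q => ?_⟩
      rw [NormedSpace.dual_def, map_smul, smul_eq_mul, Real.norm_eq_abs, abs_mul, abs_inv,
        abs_of_nonneg (hS q)]
      rcases (hS q).eq_or_lt with h0 | h0
      · rw [← h0, inv_zero, zero_mul]
        exact Real.rpow_nonneg (tsum_nonneg fun i => Real.rpow_nonneg (abs_nonneg _) p) _
      · rw [inv_mul_le_iff₀ h0]
        exact hz f q)
  refine ⟨C, fun n c hc => ?_⟩
  let q : ℕ × {c : ℕ → ℝ // ∀ i, 0 ≤ c i} := (n, ⟨c, hc⟩)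
  change ‖z q‖ ≤ C * S q
  rcases (hS q).eq_or_lt with h0 | h0
  · have : z q = 0 := SeparatingDual.eq_zero_of_forall_dual_eq_zero (R := ℝ) fun f => by
      have := hz f q
      rw [← h0, zero_mul] at this
      exact abs_nonpos_iff.1 this
    rw [this, ← h0]
    simp
  · have h := hC q
    change ‖NormedSpace.inclusionInDoubleDualLi ℝ (E := X) ((S q)⁻¹ • z q)‖ ≤ C at h
    rw [LinearIsometry.norm_map, norm_smul, norm_inv, Real.norm_of_nonneg h0.le,
      inv_mul_le_iff₀ h0] at h
    rwa [mul_comm]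

end WeaklySummable

section Lattice

variable {G : Type*} [NormedAddCommGroup G] [Lattice G] [HasSolidNorm G] [IsOrderedAddMonoid G]
  [NormedSpace ℝ G] [IsOrderedModule ℝ G] {p : ℝ}

theorem WeaklySummable.mono (hp : 0 ≤ p) {x y : ℕ → G} (hy : ∀ n, 0 ≤ y n)
    (hyx : ∀ n, y n ≤ x n) (hx : WeaklySummable p x) : WeaklySummable p y := fun f => by
  refine Summable.of_nonneg_of_le (fun n => Real.rpow_nonneg (abs_nonneg _) p) (fun n => ?_)
    (hx |f|)
  refine Real.rpow_le_rpow (abs_nonneg _) ?_ hp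
  refine (apply_le_dual_abs f (y n)).trans ((dual_apply_mono (abs_nonneg f) ?_).trans
    (le_abs_self _))
  rw [abs_of_nonneg (hy n)]
  exact hyx n

/-- The moduli of a disjoint weakly `p`-summable sequence are weakly `p`-summable. -/
theorem WeaklySummable.abs_of_disjoint (hp : 1 ≤ p) {x : ℕ → G} (hd : DisjointSeq x)
    (hx : WeaklySummable p x) : WeaklySummable p fun n => |x n| := by
  have hp0 : 0 < p := by linarith
  obtain ⟨C, hC⟩ := hx.exists_norm_sum_le hp
  have key : ∀ f : StrongDual ℝ G, 0 ≤ f → Summable fun n => f |x n| ^ p := by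
    intro f hf
    have hc : ∀ i, 0 ≤ f |x i| := fun i => hf _ (abs_nonneg _)
    refine summable_of_sum_range_le (c := (‖f‖ * C) ^ p)
      (fun n => Real.rpow_nonneg (hc n) p) fun n => ?_
    set s := ∑ i ∈ Finset.range n, f |x i| ^ p with hs
    have hs0 : 0 ≤ s := Finset.sum_nonneg fun i _ => Real.rpow_nonneg (hc i) p
    have hd' : ∀ i j, i ≠ j → |(f |x i| ^ p / f |x i|) • x i| ⊓
        |(f |x j| ^ p / f |x j|) • x j| = 0 := by
      intro i j hij
      rw [abs_smul_real, abs_smul_real]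
      refine smul_inf_eq_zero (abs_nonneg _) ?_ (abs_nonneg _)
      rw [inf_comm]
      exact smul_inf_eq_zero (abs_nonneg _) (hd j i hij.symm) (abs_nonneg _)
    -- Disjointness lets the modulus pass inside the sum without changing its norm. With `c i = f |x
    -- i|` this yields `s ≤ ‖f‖ C s ^ (1 - 1/p)`, which bounds `s` independently of `n`.
    have h1 : f |∑ i ∈ Finset.range n, (f |x i| ^ p / f |x i|) • x i| = s := by
      rw [abs_sum_range_of_disjoint hd', map_sum]
      refine Finset.sum_congr rfl fun i _ => ?_
      rw [abs_smul_real, map_smul, smul_eq_mul,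
        abs_of_nonneg (div_nonneg (Real.rpow_nonneg (hc i) p) (hc i))]
      rcases eq_or_ne (f |x i|) 0 with h0 | h0
      · rw [h0, mul_zero, Real.zero_rpow hp0.ne']
      · rw [div_mul_cancel₀ _ h0]
    have h2 : s ≤ ‖f‖ * C * s ^ (1 - p⁻¹) := by
      rw [mul_assoc]
      have h3 := (le_abs_self _).trans
        (f.le_opNorm |∑ i ∈ Finset.range n, (f |x i| ^ p / f |x i|) • x i|)
      rw [h1, norm_abs_eq_norm] at h3
      exact h3.trans (mul_le_mul_of_nonneg_left (hC n _ hc) (norm_nonneg f))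
    have hC0 : 0 ≤ C := by
      have := (norm_nonneg _).trans (hC 1 (fun _ => 1) fun _ => zero_le_one)
      simpa using this
    rcases hs0.eq_or_lt with h0 | h0
    · rw [← h0]
      exact Real.rpow_nonneg (mul_nonneg (norm_nonneg f) hC0) p
    · have h3 : s ^ p⁻¹ ≤ ‖f‖ * C := by
        have h4 : s ^ p⁻¹ * s ^ (1 - p⁻¹) = s := by
          rw [← Real.rpow_add h0, add_sub_cancel, Real.rpow_one]
        rw [← h4] at h2
        refine le_of_mul_le_mul_right (h2.trans_eq ?_) (Real.rpow_pos_of_pos h0 (1 - p⁻¹))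
        rw [h4]
      calc s = (s ^ p⁻¹) ^ p := (Real.rpow_inv_rpow hs0 hp0.ne').symm
        _ ≤ _ := Real.rpow_le_rpow (Real.rpow_nonneg hs0 _) h3 hp0.le
  intro f
  refine Summable.of_nonneg_of_le (fun n => Real.rpow_nonneg (abs_nonneg _) p) (fun n => ?_)
    (key |f| (abs_nonneg f))
  refine Real.rpow_le_rpow (abs_nonneg _) ?_ hp0.le
  simpa using apply_le_dual_abs f |x n|

end Lattice

/-! ### Schur's theorem in `ℓ₁`. -/

section Schur

theorem summable_mul_of_abs_le_one {a s : ℕ → ℝ} (ha : Summable fun k => |a k|) (hs : ∀ k, |s k| ≤ 1) :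
    Summable fun k => s k * a k :=
  Summable.of_norm_bounded ha fun k => by
    rw [Real.norm_eq_abs, abs_mul]
    exact mul_le_of_le_one_left (abs_nonneg _) (hs k)

/-- Schur's theorem: a sequence in `ℓ₁` that is null against all sequences of signs is
norm null. -/
theorem tendsto_tsum_abs_of_forall_sign {a : ℕ → ℕ → ℝ} (ha : ∀ n, Summable fun k => |a n k|)
    (h0 : ∀ k, Tendsto (fun n => a n k) atTop (𝓝 0))
    (h : ∀ s : ℕ → Bool, Tendsto (fun n => ∑' k, (if s k then 1 else -1 : ℝ) * a n k) atTop (𝓝 0)) :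
    Tendsto (fun n => ∑' k, |a n k|) atTop (𝓝 0) := by
  let σ : Bool → ℝ := fun b => if b then 1 else -1
  have hσ : ∀ b, |σ b| ≤ 1 := by rintro (_ | _) <;> simp [σ]
  let P : ℕ → (ℕ → Bool) → ℝ := fun n s => ∑' k, σ (s k) * a n k
  have hP : ∀ n, Continuous (P n) := fun n => by
    refine continuous_tsum (fun k => ?_) (ha n) fun k s => ?_
    · exact ((continuous_of_discreteTopology (f := σ)).comp (continuous_apply k)).mul
        continuous_const
    · rw [Real.norm_eq_abs, abs_mul]
      exact mul_le_of_le_one_left (abs_nonneg _) (hσ _)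
  rw [Metric.tendsto_atTop]
  intro ε hε
  -- Baire category on the Cantor space of signs: for a single `N` the bound holds on a whole
  -- cylinder, which constrains only the finitely many coordinates in `I`.
  obtain ⟨N, s₀, hs₀⟩ := nonempty_interior_of_iUnion_of_closed
    (f := fun N => {s : ℕ → Bool | ∀ n, N ≤ n → |P n s| ≤ ε / 4})
    (fun N => by
      simp only [Set.ofPred_forall]
      exact isClosed_iInter fun n => isClosed_iInter fun _ =>
        isClosed_le (hP n).abs continuous_const)
    (Set.eq_univ_of_forall fun s => by
      obtain ⟨N, hN⟩ := Metric.tendsto_atTop.1 (h s) (ε / 4) (by positivity)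
      refine Set.mem_iUnion.2 ⟨N, fun n hn => ?_⟩
      have := hN n hn
      rw [dist_zero_right] at this
      exact this.le)
  obtain ⟨I, u, hu, hsub⟩ := isOpen_pi_iff.1 isOpen_interior s₀ hs₀
  have hI : Tendsto (fun n => ∑ k ∈ I, |a n k|) atTop (𝓝 0) := by
    simpa using tendsto_finsetSum I fun k _ => (h0 k).abs
  obtain ⟨M, hM⟩ := Metric.tendsto_atTop.1 hI (ε / 4) (by positivity)
  refine ⟨max N M, fun n hn => ?_⟩
  classical
  -- Inside the cylinder, off `I`, the signs are those of `a n`. So `P n s` differs from the `ℓ₁`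
  -- norm by at most `2 ∑ k ∈ I, |a n k|`, giving a total below `3ε / 4`.
  let s : ℕ → Bool := fun k => if k ∈ I then s₀ k else decide (0 ≤ a n k)
  have hs : |P n s| ≤ ε / 4 := by
    refine interior_subset (hsub fun k hk => ?_) n ((le_max_left _ _).trans hn)
    simp only [s, if_pos (Finset.mem_coe.1 hk)]
    exact (hu k hk).2
  have hsub' : ∑' k, (|a n k| - σ (s k) * a n k) = ∑ k ∈ I, (|a n k| - σ (s k) * a n k) := by
    refine tsum_eq_sum fun k hk => ?_
    simp only [s, if_neg hk, σ, decide_eq_true_eq]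
    split_ifs with hpos
    · rw [abs_of_nonneg hpos]; ring
    · rw [abs_of_neg (not_le.1 hpos)]; ring
  rw [(ha n).tsum_sub (summable_mul_of_abs_le_one (ha n) fun k => hσ _)] at hsub'
  have hle : ∑ k ∈ I, (|a n k| - σ (s k) * a n k) ≤ ∑ k ∈ I, (|a n k| + |a n k|) := by
    refine Finset.sum_le_sum fun k _ => ?_
    have h1 : |σ (s k) * a n k| ≤ |a n k| := by
      rw [abs_mul]
      exact mul_le_of_le_one_left (abs_nonneg _) (hσ _)
    linarith [neg_abs_le (σ (s k) * a n k)]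
  rw [Finset.sum_add_distrib] at hle
  have hM' := hM n ((le_max_right _ _).trans hn)
  rw [dist_zero_right, Real.norm_of_nonneg (Finset.sum_nonneg fun k _ => abs_nonneg _)] at hM'
  rw [dist_zero_right, Real.norm_of_nonneg (tsum_nonneg fun k => abs_nonneg _)]
  have hP' : ∑' k, σ (s k) * a n k ≤ ε / 4 := (le_abs_self _).trans hs
  linarith

end Schur

/-! ### The implications of the theorem. -/

variable {E : Type*} [NormedAddCommGroup E] [Lattice E] [HasSolidNorm E] [IsOrderedAddMonoid E]
  [NormedSpace ℝ E] [IsOrderedModule ℝ E]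
  {F : Type*} [NormedAddCommGroup F] [Lattice F] [HasSolidNorm F] [IsOrderedAddMonoid F]
  [NormedSpace ℝ F] [IsOrderedModule ℝ F] {p : ℝ}

theorem WeaklyNull.tendsto_apply {f : ℕ → StrongDual ℝ F} (hf : WeaklyNull f) (x : F) :
    Tendsto (fun n => f n x) atTop (𝓝 0) :=
  hf (NormedSpace.inclusionInDoubleDual ℝ F x)

/-- Schur's theorem along the operator `x ↦ (f k x)` into `ℓ₁`. -/
theorem WeaklyNull.tendsto_tsum_abs_apply {f : ℕ → StrongDual ℝ E} (hf : ∀ n, 0 ≤ f n)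
    {h : StrongDual ℝ E} (hs : ∀ n, ∑ i ∈ Finset.range n, f i ≤ h) {x : ℕ → E}
    (hx : WeaklyNull x) : Tendsto (fun n => ∑' k, |f k (x n)|) atTop (𝓝 0) := by
  refine tendsto_tsum_abs_of_forall_sign (fun n => dual_summable_abs_apply hf hs (x n))
    (fun k => hx (f k)) fun s => ?_
  obtain ⟨L, hL⟩ := exists_operator_hasSum hf hs (y := fun k => (if s k then 1 else -1 : ℝ))
    (fun k => by split_ifs <;> simp)
  refine (hx L).congr fun n => ?_
  rw [← (hL (x n)).tsum_eq]
  simp only [smul_eq_mul, mul_comm]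

/-- If the adjoint is disjoint `p`-convergent, then the operator is almost weak `p`-convergent. -/
theorem IsDisjointPConvergent.isAlmostWeakPConvergent {T : E →L[ℝ] F}
    (hT : IsDisjointPConvergent p (adjointOp T)) : IsAlmostWeakPConvergent p T := by
  intro x f hx hd hf
  obtain ⟨C, hC⟩ := hx.exists_norm_le
  have hlim := (tendsto_norm_zero.comp (hT f hd hf)).mul_const C
  rw [zero_mul] at hlim
  refine squeeze_zero_norm (fun n => ?_) hlim
  exact ((adjointOp T (f n)).le_opNorm (x n)).trans
    (mul_le_mul_of_nonneg_left (hC n) (norm_nonneg _))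

theorem norm_adjointOp_le {T : E →L[ℝ] F} (hT : IsPositiveOperator T) (f : StrongDual ℝ F) :
    ‖adjointOp T f‖ ≤ ‖adjointOp T |f|‖ := by
  refine HasSolidNorm.solid (le_trans (abs_le'.2 ⟨fun x hx => ?_, fun x hx => ?_⟩)
    (le_abs_self _))
  · exact le_abs_self f (T x) (hT x hx)
  · exact neg_le_abs f (T x) (hT x hx)

theorem disjointSeq_abs {x : ℕ → F} (hx : DisjointSeq x) : DisjointSeq fun n => |x n| :=
  fun m n hmn => by simpa only [abs_abs] using hx m n hmn

theorem HasPositiveSchurProperty.isDisjointPConvergent (hp : 1 ≤ p)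
    (hF : HasPositiveSchurProperty p F) {X : Type*} [NormedAddCommGroup X] [NormedSpace ℝ X]
    (S : F →L[ℝ] X) : IsDisjointPConvergent p S := by
  intro x hd hx
  have h := hF _ (fun n => abs_nonneg (x n)) (hx.abs_of_disjoint hp hd)
  rw [tendsto_zero_iff_norm_tendsto_zero] at h
  simp only [norm_abs_eq_norm] at h
  simpa [Function.comp_def] using (S.continuous.tendsto 0).comp (tendsto_zero_iff_norm_tendsto_zero.2 h)

theorem HasOrderContinuousNorm.isDisjointPConvergent_adjointOp [CompleteSpace E] (hp : 1 ≤ p)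
    (hE : HasOrderContinuousNorm (StrongDual ℝ E)) {T : E →L[ℝ] F} (hT : IsPositiveOperator T)
    (hT' : IsAlmostWeakPConvergent p T) : IsDisjointPConvergent p (adjointOp T) := by
  intro f hd hf
  have hd' := disjointSeq_abs hd
  have hf' := hf.abs_of_disjoint hp hd
  have hlim : Tendsto (fun n => adjointOp T |f n|) atTop (𝓝 0) := by
    by_contra hcon
    obtain ⟨δ, hδ, φ, hφ, y, hy0, hy1, hyd, hy⟩ := exists_disjoint_of_not_tendsto_norm
      (fun n x hx => (abs_nonneg (f n)) (T x) (hT x hx))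
      (fun x => (hf'.weaklyNull (by linarith)).tendsto_apply (T x)) hcon
    have hnull := hT' y _ (hE.weaklyNull_of_disjoint hy0 hy1 hyd)
      (fun m n hmn => hd' _ _ (hφ.injective.ne hmn)) (hf'.comp_injective hφ.injective)
    exact absurd (ge_of_tendsto' hnull hy) (not_le.2 hδ)
  exact squeeze_zero_norm (fun n => norm_adjointOp_le hT (f n)) (tendsto_norm_zero.comp hlim)

/-- If a dual fails the positive Schur property of order `p`, then the failure is witnessed by a
disjoint sequence of positive functionals. -/
theorem exists_disjoint_of_not_hasPositiveSchurProperty [CompleteSpace F] (hp : 1 ≤ p)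
    (hF : ¬ HasPositiveSchurProperty p (StrongDual ℝ F)) :
    ∃ δ : ℝ, 0 < δ ∧ ∃ g : ℕ → StrongDual ℝ F, (∀ n, 0 ≤ g n) ∧ DisjointSeq g ∧
      WeaklySummable p g ∧ ∃ y : ℕ → F, (∀ n, 0 ≤ y n) ∧ (∀ n, ‖y n‖ ≤ 1) ∧
        ∀ n, δ ≤ g n (y n) := by
  simp only [HasPositiveSchurProperty, not_forall] at hF
  obtain ⟨f, hf0, hf, hcon⟩ := hF
  obtain ⟨δ, hδ, φ, hφ, y, hy0, hy1, hyd, hy⟩ := exists_disjoint_of_not_tendsto_norm hf0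
    (hf.weaklyNull (by linarith)).tendsto_apply hcon
  -- Cutting `f (φ n)` down to the band of `y n` makes the functionals disjoint. Domination by `f (φ
  -- n)` keeps them weakly `p`-summable, and the value at `y n` is unchanged.
  choose g hg using fun n => exists_isComponent (hf0 (φ n)) (hy0 n)
  have hg0 : ∀ n, 0 ≤ g n := fun n => (hg n).nonneg (hf0 _) (hy0 n)
  refine ⟨δ, hδ, g, hg0, fun m n hmn => ?_, ?_, y, hy0, hy1, fun n => ?_⟩
  · rw [abs_of_nonneg (hg0 m), abs_of_nonneg (hg0 n)]
    exact (hg m).inf_eq_zero (hg n) (hf0 _) (hf0 _) (hy0 m) (hy0 n) (hyd m n hmn)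
  · exact (hf.comp_injective hφ.injective).mono (by linarith) hg0 fun n => (hg n).le (hf0 _)
  · rw [(hg n).apply_self (hy0 n)]
    exact hy n

/-- The witness is `x ↦ ∑ f k x • y k`, built from the two failing sequences: compact-like behaviour
through `ℓ₁` on one side, and `T* g n ≥ g n (y n) • f n` on the other. -/
theorem exists_isAlmostWeakPConvergent_not_isDisjointPConvergent_adjointOp [CompleteSpace F]
    (hp : 1 ≤ p) (hE : ¬ HasOrderContinuousNorm (StrongDual ℝ E))
    (hF : ¬ HasPositiveSchurProperty p (StrongDual ℝ F)) :
    ∃ T : E →L[ℝ] F, IsPositiveOperator T ∧ IsAlmostWeakPConvergent p T ∧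
      ¬ IsDisjointPConvergent p (adjointOp T) := by
  obtain ⟨δ, hδ, f, hf0, hf, h, hs⟩ := exists_sum_le_of_not_hasOrderContinuousNorm hE
  obtain ⟨δ', hδ', g, hg0, hgd, hg, y, hy0, hy1, hy⟩ :=
    exists_disjoint_of_not_hasPositiveSchurProperty hp hF
  obtain ⟨T, hT⟩ := exists_operator_hasSum hf0 hs hy1
  refine ⟨T, fun x hx => (hT x).nonneg fun k => smul_nonneg (hf0 k x hx) (hy0 k), ?_, ?_⟩
  · intro x φ hx _ hφ
    obtain ⟨C, hC⟩ := (hφ.weaklyNull (by linarith)).exists_norm_le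
    have hlim := (hx.tendsto_tsum_abs_apply hf0 hs).const_mul C
    rw [mul_zero] at hlim
    refine squeeze_zero_norm (fun n => ?_) hlim
    refine ((φ n).le_of_opNorm_le (hC n) _).trans
      (mul_le_mul_of_nonneg_left ?_ ((norm_nonneg _).trans (hC n)))
    rw [← (hT (x n)).tsum_eq]
    refine tsum_of_norm_bounded (dual_summable_abs_apply hf0 hs (x n)).hasSum fun k => ?_
    rw [norm_smul, Real.norm_eq_abs]
    exact mul_le_of_le_one_right (abs_nonneg _) (hy1 k)
  · intro hcon
    -- Positive vectors of the unit ball that norm `f n` up to a factor: `δ / 2` is just some value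
    -- strictly below `‖f n‖`.
    choose u hu0 hu1 hu using fun n =>
      exists_nonneg_lt_apply (hf0 n) ((half_lt_self hδ).trans_le (hf n))
    have hlow : ∀ n, δ / 2 * δ' ≤ ‖adjointOp T (g n)‖ := fun n => by
      have h1 : f n (u n) • y n ≤ T (u n) :=
        le_hasSum (hT (u n)) n fun k _ => smul_nonneg (hf0 k _ (hu0 n)) (hy0 k)
      have h2 := dual_apply_mono (hg0 n) h1
      rw [map_smul, smul_eq_mul] at h2
      calc δ / 2 * δ' ≤ f n (u n) * g n (y n) :=
            mul_le_mul (hu n).le (hy n) hδ'.le (hf0 n _ (hu0 n))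
        _ ≤ g n (T (u n)) := h2
        _ ≤ ‖adjointOp T (g n) (u n)‖ := le_abs_self _
        _ ≤ ‖adjointOp T (g n)‖ := (adjointOp T (g n)).unit_le_opNorm _ (hu1 n)
    have := ge_of_tendsto' (tendsto_norm_zero.comp (hcon g hgd hg)) hlow
    exact absurd this (not_le.2 (by positivity))

end BanachLat

end

theorem theorem3p12
    {E : Type*} [NormedAddCommGroup E] [Lattice E] [HasSolidNorm E] [IsOrderedAddMonoid E]
    [NormedSpace ℝ E] [IsOrderedModule ℝ E] [CompleteSpace E]
    {F : Type*} [NormedAddCommGroup F] [Lattice F] [HasSolidNorm F] [IsOrderedAddMonoid F]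
    [NormedSpace ℝ F] [IsOrderedModule ℝ F] [CompleteSpace F]
    (p : ℝ) (hp : 1 ≤ p) :
    List.TFAE [
      BanachLat.HasOrderContinuousNorm (StrongDual ℝ E) ∨
        BanachLat.HasPositiveSchurProperty p (StrongDual ℝ F),
      ∀ T : E →L[ℝ] F, BanachLat.IsPositiveOperator T →
        BanachLat.IsAlmostWeakPConvergent p T →
          BanachLat.IsDisjointPConvergent p (BanachLat.adjointOp T),
      ∀ T : E →L[ℝ] F, BanachLat.IsPositiveOperator T →
        (BanachLat.IsAlmostWeakPConvergent p T ↔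
          BanachLat.IsDisjointPConvergent p (BanachLat.adjointOp T))] := by
  tfae_have 1 → 3
  | Or.inl hE => fun T hT => ⟨hE.isDisjointPConvergent_adjointOp hp hT,
      BanachLat.IsDisjointPConvergent.isAlmostWeakPConvergent⟩
  | Or.inr hF => fun T _ => ⟨fun _ => hF.isDisjointPConvergent hp _,
      BanachLat.IsDisjointPConvergent.isAlmostWeakPConvergent⟩
  tfae_have 3 → 2 := fun h T hT => (h T hT).1
  tfae_have 2 → 1 := by
    intro h
    by_contra! hcon
    obtain ⟨T, hT, hT₁, hT₂⟩ :=
      BanachLat.exists_isAlmostWeakPConvergent_not_isDisjointPConvergent_adjointOp hp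
        hcon.1 hcon.2
    exact hT₂ (h T hT hT₁)
  tfae_finish
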